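/- Let $\mathfrak H$ be a complex Hilbert space with inner product $(\cdot,\cdot)$ and let $J$ be a nontrivial fundamental symmetry in $\mathfrak H$, i.e. a bounded operator with $J=J^*$, $J^2=I$, $J\neq\pm I$. Let $S$ be a densely defined symmetric operator in $\mathfrak H$ with equal defect numbers such that $SJ=JS$. (Equalities of products of unbounded operators include equality of the natural domains.) Let $\{C_\alpha\}_{\alpha\in D}$ be the set of all bounded everywhere defined operators $C$ in $\mathfrak H$ with $C^2=I$, $JC>0$ (that is, $JC$ is self-adjoint and $(JCx,x)>0$ for $x\ne0$) and $SC=CS$; put $(x,y)_\alpha=(JC_\alpha x,y)$, which is an inner product on $\mathfrak H$. Let $\Upsilon$ be the set of all operators $A\supset S$ in $\mathfrak H$ with $A^*J=JA$ and $AC_\alpha=C_\alpha A$ for all $\alpha\in D$. Then: (i) If $A\in\Upsilon$, then for every $\alpha\in D$ the operator $A$ is a self-adjoint extension of $S$ with respect to the inner product $(\cdot,\cdot)_\alpha$. (ii) If $S$ is closed and $r\in\mathbb R$ is a point of regular type of $S$, i.e. there is $k>0$ with $\|(S-rI)x\|\ge k\|x\|$ for all $x\in\mathcal D(S)$, then the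 operator $A_r=S^*\upharpoonright\bigl(\mathcal D(S)+\ker(S^*-rI)\bigr)$ belongs to $\Upsilon$. (iii) If $S$ is closed and $A\in\Upsilon$, then there is a self-adjoint extension $A'\supset S$ (with respect to $(\cdot,\cdot)$) that is transversal to $A$, i.e. $\mathcal D(A)\cap\mathcal D(A')=\mathcal D(S)$ and $\mathcal D(A)+\mathcal D(A')=\mathcal D(S^*)$, and that belongs to $\Upsilon$. (iv) If $S$ is nonnegative, i.e. $(Sx,x)\ge0$ for all $x\in\mathcal D(S)$, then its Friedrichs extension $A_F$ and its Krein–von Neumann extension $A_N$ belong to $\Upsilon$. Here $A_F$ is the restriction of $S^*$ to those $f\in\mathcal D(S^*)$ for which there are $h_n\in\mathcal D(S)$ with $h_n\to f$ and $(S(h_m-h_n),h_m-h_n)\to0$ as $m,n\to\infty$; and $A_N=((S^{-1})_F)^{-1}$ in the sense of linear relations, i.e. the restriction of $S^*$ to those $f\in\mathcal D(S^*)$ for which there are $h_n\in\mathcal D(S)$ with $Sh_n\to S^*f$ and $(S(h_m-h_n),h_m-h_n)\to0$ as $m,n\to\infty$. -/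

import Mathlib

open scoped InnerProductSpace Topology ComplexConjugate

namespace CSymm

noncomputable section

/-! Unbounded operators in a complex Hilbert space `H` are partial linear maps `H →ₗ.[ℂ] H`.
Mathlib's inner product is conjugate linear in the first argument, so the inner product `(x, y)`
that is linear in its first argument is `⟪y, x⟫_ℂ`. -/

variable {H : Type*} [NormedAddCommGroup H] [InnerProductSpace ℂ H]

/-- The product `A B` of an unbounded operator `A` and a bounded, everywhere defined operator `B`,
with its natural domain `{x | B x ∈ D(A)}`. -/
def compBounded (A : H →ₗ.[ℂ] H) (B : H →L[ℂ] H) : H →ₗ.[ℂ] H where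
  domain := A.domain.comap (B : H →ₗ[ℂ] H)
  toFun := A.toFun ∘ₗ
    (B : H →ₗ[ℂ] H).restrict (p := A.domain.comap (B : H →ₗ[ℂ] H)) (q := A.domain)
      (fun _ hx => hx)

/-- The product `B A` of a bounded, everywhere defined operator `B` and an unbounded operator `A`,
with its natural domain `D(A)`. -/
def boundedComp (B : H →L[ℂ] H) (A : H →ₗ.[ℂ] H) : H →ₗ.[ℂ] H :=
  (B : H →ₗ[ℂ] H).compPMap A

/-- `[A, B] = 0`: equality `A B = B A` of unbounded operators, domains included. -/
def Commutes (A : H →ₗ.[ℂ] H) (B : H →L[ℂ] H) : Prop :=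
  compBounded A B = boundedComp B A

/-- `S` is a densely defined symmetric operator. -/
structure IsSymm (S : H →ₗ.[ℂ] H) : Prop where
  dense : Dense (S.domain : Set H)
  symm : S.IsFormalAdjoint S

/-- `(S x, x) ≥ 0` for all `x ∈ D(S)` (used for symmetric `S`, where `(S x, x)` is real). -/
def IsNonneg (S : H →ₗ.[ℂ] H) : Prop :=
  ∀ x : S.domain, 0 ≤ (⟪(x : H), S x⟫_ℂ).re

/-- `r` is a (real) point of regular type of `S`. -/
def IsRegularTypePoint (S : H →ₗ.[ℂ] H) (r : ℝ) : Prop :=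
  ∃ k : ℝ, 0 < k ∧ ∀ x : S.domain, k * ‖(x : H)‖ ≤ ‖S x - (r : ℂ) • (x : H)‖

/-- `ker (T - μ I)` for an unbounded operator `T`. -/
def kerSub (T : H →ₗ.[ℂ] H) (μ : ℂ) : Submodule ℂ H :=
  T.graph.comap (LinearMap.id.prod (μ • LinearMap.id))

section Adjoint

variable [CompleteSpace H]

/-- A nontrivial fundamental symmetry: `J = J*`, `J² = I`, `J ≠ ± I`. -/
structure IsFundamentalSymmetry (J : H →L[ℂ] H) : Prop where
  selfAdjoint : IsSelfAdjoint J
  sq : J ∘L J = ContinuousLinearMap.id ℂ H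
  ne_one : J ≠ ContinuousLinearMap.id ℂ H
  ne_neg_one : J ≠ -ContinuousLinearMap.id ℂ H

/-- Equal defect numbers: the closed subspaces `ker (S* - i)` and `ker (S* + i)` have the same
Hilbert space dimension, that is, they are isometrically isomorphic. -/
def EqualDefectNumbers (S : H →ₗ.[ℂ] H) : Prop :=
  Nonempty (kerSub S.adjoint Complex.I ≃ₗᵢ[ℂ] kerSub S.adjoint (-Complex.I))

/-- `A` has the `C`-symmetry in the Krein space with fundamental symmetry `J`:
`C² = I`, `J C > 0` and `A C = C A`. -/
structure HasCSymmetry (J : H →L[ℂ] H) (A : H →ₗ.[ℂ] H) (C : H →L[ℂ] H) : Prop where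
  sq : C ∘L C = ContinuousLinearMap.id ℂ H
  selfAdjoint : IsSelfAdjoint (J ∘L C)
  pos : ∀ x : H, x ≠ 0 → 0 < (⟪x, J (C x)⟫_ℂ).re
  comm : Commutes A C

/-- The inner product `(x, y)_C = (J C x, y)` attached to a `C`-symmetry; the function `inner` below
is conjugate linear in the first argument, that is, `inner y x = (x, y)_C`. -/
@[reducible]
def HasCSymmetry.core {J : H →L[ℂ] H} {A : H →ₗ.[ℂ] H} {C : H →L[ℂ] H}
    (h : HasCSymmetry J A C) : InnerProductSpace.Core ℂ H where
  inner y x := ⟪y, J (C x)⟫_ℂ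
  conj_inner_symm x y := by
    have h1 : ⟪(J ∘L C) x, y⟫_ℂ = ⟪x, (J ∘L C) y⟫_ℂ := h.selfAdjoint.isSymmetric x y
    rw [inner_conj_symm]
    exact h1
  re_inner_nonneg x := by
    by_cases hx : x = 0
    · simp [hx]
    · exact (h.pos x hx).le
  add_left x y z := inner_add_left _ _ _
  smul_left x y r := inner_smul_left _ _ _
  definite x hx := by
    by_contra h0
    have h1 := h.pos x h0
    rw [hx] at h1
    simp at h1

/-- `A` is self-adjoint with respect to the inner product `c` (possibly different from the given
inner product of `H`): its domain is dense in the norm of `c`, and `A` equals its adjoint with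
respect to `c`, i.e. `(y, z)` is in the graph of `A` iff `(A x, y)_c = (x, z)_c` for all
`x ∈ D(A)`. -/
def IsSelfAdjointFor (c : InnerProductSpace.Core ℂ H) (A : H →ₗ.[ℂ] H) : Prop :=
  (∀ x : H, ∀ ε : ℝ, 0 < ε → ∃ d ∈ A.domain, (c.inner (x - d) (x - d)).re < ε) ∧
  ∀ y z : H, (y, z) ∈ A.graph ↔ ∀ x : A.domain, c.inner y (A x) = c.inner z (x : H)

/-- The `J`-self-adjoint extensions of `S`: `S ⊆ A` and `A* J = J A`. -/
def SigmaJ (J : H →L[ℂ] H) (S : H →ₗ.[ℂ] H) : Set (H →ₗ.[ℂ] H) :=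
  {A | S ≤ A ∧ compBounded A.adjoint J = boundedComp J A}

/-- The `J`-self-adjoint extensions of `S` that commute with every operator `C` realizing the
property of `C`-symmetry for `S`. -/
def Upsilon (J : H →L[ℂ] H) (S : H →ₗ.[ℂ] H) : Set (H →ₗ.[ℂ] H) :=
  {A | A ∈ SigmaJ J S ∧ ∀ C : H →L[ℂ] H, HasCSymmetry J S C → Commutes A C}

/-- The operator `A_r`: the restriction of `S*` to `D(S) + ker (S* - r I)`. -/
def regularExtension (S : H →ₗ.[ℂ] H) (r : ℝ) : H →ₗ.[ℂ] H :=
  S.adjoint.domRestrict (S.domain ⊔ kerSub S.adjoint (r : ℂ))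

/-- Two extensions `A`, `A'` of `S` are transversal: `D(A) ∩ D(A') = D(S)` and
`D(A) + D(A') = D(S*)`. -/
def Transversal (S A A' : H →ₗ.[ℂ] H) : Prop :=
  A.domain ⊓ A'.domain = S.domain ∧ A.domain ⊔ A'.domain = S.adjoint.domain

end Adjoint

/-! ### The Friedrichs and Krein-von Neumann extensions -/

/-- The sequence `h` in `D(S)` is Cauchy for the quadratic form `(S x, x)`:
`(S (h m - h n), h m - h n) → 0` as `m, n → ∞`. -/
def FormCauchy (S : H →ₗ.[ℂ] H) (h : ℕ → S.domain) : Prop :=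
  Filter.Tendsto (fun p : ℕ × ℕ => (⟪((h p.1 - h p.2 : S.domain) : H), S (h p.1 - h p.2)⟫_ℂ).re)
    Filter.atTop (𝓝 0)

theorem FormCauchy.zero (S : H →ₗ.[ℂ] H) : FormCauchy S (fun _ => 0) := by
  simp [FormCauchy]

theorem FormCauchy.add {S : H →ₗ.[ℂ] H} (hS : IsNonneg S) {h k : ℕ → S.domain}
    (hh : FormCauchy S h) (hk : FormCauchy S k) : FormCauchy S (fun n => h n + k n) := by
  have key : ∀ a b : S.domain, (⟪((a + b : S.domain) : H), S (a + b)⟫_ℂ).re ≤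
      2 * (⟪(a : H), S a⟫_ℂ).re + 2 * (⟪(b : H), S b⟫_ℂ).re := by
    intro a b
    have h0 := hS (a - b)
    simp only [LinearPMap.map_sub, LinearPMap.map_add, Submodule.coe_sub, Submodule.coe_add,
      inner_sub_left, inner_sub_right, inner_add_left, inner_add_right, Complex.add_re,
      Complex.sub_re] at h0 ⊢
    linarith
  have hlim := (hh.const_mul 2).add (hk.const_mul 2)
  simp only [mul_zero, add_zero] at hlim
  refine squeeze_zero (fun p => hS _) (fun p => ?_) hlim
  have e : (h p.1 + k p.1) - (h p.2 + k p.2) = (h p.1 - h p.2) + (k p.1 - k p.2) := by abel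
  simp only [e]
  exact key _ _

theorem FormCauchy.smul {S : H →ₗ.[ℂ] H} (c : ℂ) {h : ℕ → S.domain}
    (hh : FormCauchy S h) : FormCauchy S (fun n => c • h n) := by
  have hlim := hh.const_mul (Complex.normSq c)
  rw [mul_zero] at hlim
  refine hlim.congr fun p => ?_
  have e : c • h p.1 - c • h p.2 = c • (h p.1 - h p.2) := by rw [smul_sub]
  rw [e, LinearPMap.map_smul, Submodule.coe_smul, inner_smul_left, inner_smul_right, ← mul_assoc,
    mul_comm (conj c), Complex.mul_conj, Complex.re_ofReal_mul]

/-- The domain of the closure of the quadratic form `(S x, x)`, `x ∈ D(S)` (the energy space): all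
`f` for which there are `h n ∈ D(S)` with `h n → f` and `(S (h m - h n), h m - h n) → 0`. -/
def formDomain (S : H →ₗ.[ℂ] H) (hS : IsNonneg S) : Submodule ℂ H where
  carrier := {f | ∃ h : ℕ → S.domain,
    Filter.Tendsto (fun n => (h n : H)) Filter.atTop (𝓝 f) ∧ FormCauchy S h}
  zero_mem' := ⟨fun _ => 0, by simp, FormCauchy.zero S⟩
  add_mem' := by
    rintro a b ⟨h, h1, h2⟩ ⟨k, k1, k2⟩
    exact ⟨fun n => h n + k n, by simpa using h1.add k1, h2.add hS k2⟩
  smul_mem' := by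
    rintro c a ⟨h, h1, h2⟩
    exact ⟨fun n => c • h n, by simpa using h1.const_smul c, h2.smul c⟩

/-- The domain of the closure of the inverse form `(g, S⁻¹ g)`, `g ∈ ran S`, where `S⁻¹` is a linear
relation: all `g` for which there are `h n ∈ D(S)` with `S (h n) → g` and
`(S (h m - h n), h m - h n) → 0`. -/
def inverseFormDomain (S : H →ₗ.[ℂ] H) (hS : IsNonneg S) : Submodule ℂ H where
  carrier := {g | ∃ h : ℕ → S.domain,
    Filter.Tendsto (fun n => S (h n)) Filter.atTop (𝓝 g) ∧ FormCauchy S h}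
  zero_mem' := ⟨fun _ => 0, by simp, FormCauchy.zero S⟩
  add_mem' := by
    rintro a b ⟨h, h1, h2⟩ ⟨k, k1, k2⟩
    exact ⟨fun n => h n + k n, by simpa [LinearPMap.map_add] using h1.add k1, h2.add hS k2⟩
  smul_mem' := by
    rintro c a ⟨h, h1, h2⟩
    exact ⟨fun n => c • h n, by simpa [LinearPMap.map_smul] using h1.const_smul c, h2.smul c⟩

variable [CompleteSpace H]

/-- The Friedrichs extension of a densely defined nonnegative symmetric operator: the restriction
of `S*` to the vectors of `D(S*)` in the domain of the closure of the form `(S x, x)`. -/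
def friedrichsExtension (S : H →ₗ.[ℂ] H) (hS : IsNonneg S) : H →ₗ.[ℂ] H :=
  S.adjoint.domRestrict (formDomain S hS)

/-- The Krein-von Neumann extension `((S⁻¹)_F)⁻¹` of a densely defined nonnegative symmetric
operator, where `(S⁻¹)_F` is the Friedrichs extension of the linear relation `S⁻¹`. Since
`(S⁻¹)* = (S*)⁻¹`, this is the restriction of `S*` to the vectors `f ∈ D(S*)` such that `S* f` is in
the domain of the closure of the inverse form. -/
def kreinVonNeumannExtension (S : H →ₗ.[ℂ] H) (hS : IsNonneg S) : H →ₗ.[ℂ] H :=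
  S.adjoint.domRestrict
    (((inverseFormDomain S hS).comap S.adjoint.toFun).map S.adjoint.domain.subtype)

end

end CSymm

/-! The fundamental symmetry `J` is itself one of the operators `C`, because `J J = I > 0`. Hence
every `A` in `Upsilon J S` commutes with `J`, and `A* J = J A` reduces to `A* = A`: the set consists
of the self-adjoint extensions of `S` commuting with every `C`. Since `C² = I`, commuting means that
the graph is invariant under `(x, y) ↦ (C x, C y)`. Self-adjointness of `J C` gives `C* = J C J`, so
`C*` also preserves the graph of `S`, and by duality `C` preserves that of `S*`. Any extension built
from `S`, `S*` and an invariant `A` by linear conditions then inherits the invariance.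

(i) `J C` is a self-adjoint bijection preserving the graph of `A`, so it carries one adjoint
condition to the other.

(ii) `ran (S - r)` is closed at a point of regular type, so it is the orthogonal complement of `ker
(S* - r)`; this yields maximality of `A_r`.

(iii) In `H × H` the orthogonal complement of the graph of a self-adjoint `A` is that graph rotated
by `(f, g) ↦ (g, -f)`. Rotating only the part of `A` orthogonal to `S` and adding `S` gives a
transversal self-adjoint extension.

(iv) Both extensions are treated at once as Friedrichs extensions of nonnegative linear relations,
the graph of `S` and its inverse. Self-adjointness comes from the Riesz theorem in the energy space.
As `C` need not be unitary, invariance requires that it preserve form-Cauchy sequences; this is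
Reid's inequality for `C* C`. -/

namespace CSymm

noncomputable section

/-! ### Operators and their graphs -/

section Graph

variable {H : Type*} [NormedAddCommGroup H] [InnerProductSpace ℂ H]

/-- The graph of `A` is mapped into itself by `(x, y) ↦ (B x, B y)`, that is, `B A ⊆ A B`. -/
def GraphInvariant (B : H →L[ℂ] H) (A : H →ₗ.[ℂ] H) : Prop :=
  ∀ x y : H, (x, y) ∈ A.graph → (B x, B y) ∈ A.graph

theorem mem_graph_domRestrict {A : H →ₗ.[ℂ] H} {M : Submodule ℂ H} {x y : H} :
    (x, y) ∈ (A.domRestrict M).graph ↔ x ∈ M ∧ (x, y) ∈ A.graph := by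
  constructor
  · intro h
    refine ⟨?_, LinearPMap.le_graph_of_le LinearPMap.domRestrict_le h⟩
    exact (LinearPMap.mem_domain_of_mem_graph h).1
  · rintro ⟨hx, h⟩
    obtain ⟨z, hz, hy⟩ := (LinearPMap.mem_graph_iff A).1 h
    simp only at hz hy
    subst hz hy
    have h2 : (z : H) ∈ (A.domRestrict M).domain := ⟨hx, z.2⟩
    exact (LinearPMap.mem_graph_iff _).2 ⟨⟨z, h2⟩, rfl, LinearPMap.domRestrict_apply rfl⟩

theorem mem_kerSub {A : H →ₗ.[ℂ] H} {μ : ℂ} {x : H} :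
    x ∈ kerSub A μ ↔ (x, μ • x) ∈ A.graph := Iff.rfl

theorem mem_graph_compBounded {A : H →ₗ.[ℂ] H} {B : H →L[ℂ] H} {x y : H} :
    (x, y) ∈ (compBounded A B).graph ↔ (B x, y) ∈ A.graph := by
  rw [LinearPMap.mem_graph_iff, LinearPMap.mem_graph_iff]
  constructor
  · rintro ⟨z, hz, hy⟩
    simp only at hz hy
    subst hz
    exact ⟨⟨B z, z.2⟩, rfl, hy⟩
  · rintro ⟨z, hz, hy⟩
    simp only at hz hy
    refine ⟨⟨x, ?_⟩, rfl, ?_⟩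
    · change B x ∈ A.domain
      exact hz ▸ z.2
    · rw [← hy]
      exact congrArg A.toFun (Subtype.ext hz.symm)

theorem mem_graph_boundedComp {A : H →ₗ.[ℂ] H} {B : H →L[ℂ] H} {x y : H} :
    (x, y) ∈ (boundedComp B A).graph ↔ ∃ w, (x, w) ∈ A.graph ∧ B w = y := by
  rw [LinearPMap.mem_graph_iff]
  constructor
  · rintro ⟨z, hz, hy⟩
    simp only at hz hy
    subst hz
    exact ⟨A z, A.mem_graph z, hy⟩
  · rintro ⟨w, hw, rfl⟩
    obtain ⟨z, hz, hy⟩ := (LinearPMap.mem_graph_iff A).1 hw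
    simp only at hz hy
    subst hz hy
    exact ⟨z, rfl, rfl⟩

/-- Invariance is only the inclusion `B A ⊆ A B`; since `B` is its own inverse, applying the
inclusion once more to `(B x, y)` gives the reverse one. -/
theorem commutes_iff_graphInvariant {A : H →ₗ.[ℂ] H} {B : H →L[ℂ] H}
    (hB : B ∘L B = ContinuousLinearMap.id ℂ H) : Commutes A B ↔ GraphInvariant B A := by
  have hBB : ∀ x, B (B x) = x := fun x => congrArg (fun T : H →L[ℂ] H => T x) hB
  constructor
  · intro h x y hxy
    rw [← mem_graph_compBounded, h, mem_graph_boundedComp]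
    exact ⟨y, hxy, rfl⟩
  · intro h
    refine LinearPMap.eq_of_eq_graph (Submodule.ext fun p => ?_)
    obtain ⟨x, y⟩ := p
    rw [mem_graph_compBounded, mem_graph_boundedComp]
    constructor
    · intro hxy
      refine ⟨B y, ?_, hBB y⟩
      simpa [hBB] using h _ _ hxy
    · rintro ⟨w, hw, rfl⟩
      exact h _ _ hw

theorem GraphInvariant.comp {A : H →ₗ.[ℂ] H} {B C : H →L[ℂ] H} (hB : GraphInvariant B A)
    (hC : GraphInvariant C A) : GraphInvariant (B ∘L C) A :=
  fun x y h => hB _ _ (hC x y h)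

theorem IsSymm.inner_graph {S : H →ₗ.[ℂ] H} (hS : IsSymm S) {x y a b : H}
    (h : (x, y) ∈ S.graph) (h' : (a, b) ∈ S.graph) : ⟪x, b⟫_ℂ = ⟪y, a⟫_ℂ := by
  obtain ⟨u, hu, hu'⟩ := (LinearPMap.mem_graph_iff S).1 h
  obtain ⟨v, hv, hv'⟩ := (LinearPMap.mem_graph_iff S).1 h'
  simp only at hu hu' hv hv'
  subst hu hu' hv hv'
  exact (hS.symm u v).symm

variable [CompleteSpace H]

theorem mem_graph_adjoint_iff {A : H →ₗ.[ℂ] H} (hA : Dense (A.domain : Set H)) {y z : H} :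
    (y, z) ∈ A.adjoint.graph ↔ ∀ a b, (a, b) ∈ A.graph → ⟪y, b⟫_ℂ = ⟪z, a⟫_ℂ := by
  rw [LinearPMap.adjoint_graph_eq_graph_adjoint hA, Submodule.mem_adjoint_iff]
  refine forall₃_congr fun a b _ => ?_
  rw [sub_eq_zero, ← inner_conj_symm b, ← inner_conj_symm a]
  exact (starRingEnd ℂ).injective.eq_iff

theorem IsSymm.le_adjoint {S : H →ₗ.[ℂ] H} (hS : IsSymm S) : S ≤ S.adjoint :=
  hS.symm.le_adjoint hS.dense

theorem IsSymm.graph_adjoint {S : H →ₗ.[ℂ] H} (hS : IsSymm S) {x y : H}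
    (h : (x, y) ∈ S.graph) : (x, y) ∈ S.adjoint.graph :=
  LinearPMap.le_graph_of_le hS.le_adjoint h

theorem mem_graph_iff_of_isSelfAdjoint {A : H →ₗ.[ℂ] H} (hA : IsSelfAdjoint A) {y z : H} :
    (y, z) ∈ A.graph ↔ ∀ a b, (a, b) ∈ A.graph → ⟪y, b⟫_ℂ = ⟪z, a⟫_ℂ := by
  rw [← mem_graph_adjoint_iff hA.dense_domain, LinearPMap.isSelfAdjoint_def.1 hA]

theorem isSelfAdjoint_of_graph {A : H →ₗ.[ℂ] H} (hA : Dense (A.domain : Set H))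
    (hsymm : ∀ x y a b, (x, y) ∈ A.graph → (a, b) ∈ A.graph → ⟪x, b⟫_ℂ = ⟪y, a⟫_ℂ)
    (hmax : ∀ x y, (∀ a b, (a, b) ∈ A.graph → ⟪x, b⟫_ℂ = ⟪y, a⟫_ℂ) → (x, y) ∈ A.graph) :
    IsSelfAdjoint A := by
  refine LinearPMap.isSelfAdjoint_def.2 (LinearPMap.eq_of_eq_graph (Submodule.ext fun p => ?_))
  obtain ⟨x, y⟩ := p
  rw [mem_graph_adjoint_iff hA]
  exact ⟨hmax x y, fun h a b h' => hsymm x y a b h h'⟩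

theorem GraphInvariant.adjoint {A : H →ₗ.[ℂ] H} (hA : Dense (A.domain : Set H))
    {B : H →L[ℂ] H} (h : GraphInvariant (ContinuousLinearMap.adjoint B) A) :
    GraphInvariant B A.adjoint := by
  intro x y hxy
  rw [mem_graph_adjoint_iff hA] at hxy ⊢
  intro a b hab
  have := hxy _ _ (h a b hab)
  rwa [ContinuousLinearMap.adjoint_inner_right, ContinuousLinearMap.adjoint_inner_right] at this

/-- Projection onto a closed subspace of `H × H` with respect to the Hilbert sum inner product. -/
theorem exists_decomp_of_isClosed {G : Submodule ℂ (H × H)} (hG : IsClosed (G : Set (H × H)))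
    (p : H × H) :
    ∃ q ∈ G, ∀ r ∈ G, ⟪p.1 - q.1, r.1⟫_ℂ + ⟪p.2 - q.2, r.2⟫_ℂ = 0 := by
  -- `H × H` carries the sup norm, so the projection is taken in the `ℓ²` product, which has the
  -- same topology.
  let e := WithLp.prodContinuousLinearEquiv 2 ℂ H H
  let K : Submodule ℂ (WithLp 2 (H × H)) := G.comap (e : WithLp 2 (H × H) →ₗ[ℂ] H × H)
  have hK : IsClosed (K : Set (WithLp 2 (H × H))) := hG.preimage e.continuous
  have : CompleteSpace K := hK.completeSpace_coe
  let q := K.starProjection (e.symm p)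
  have hq : q ∈ K := K.starProjection_apply_mem _
  refine ⟨e q, hq, fun r hr => ?_⟩
  have hr' : e.symm r ∈ K := by
    change e (e.symm r) ∈ G
    simpa using hr
  have := K.starProjection_inner_eq_zero (e.symm p) (e.symm r) hr'
  rw [WithLp.prod_inner_apply] at this
  exact this

end Graph

/-! ### Operators commuting with `C`-symmetries -/

section Symmetries

variable {H : Type*} [NormedAddCommGroup H] [InnerProductSpace ℂ H] [CompleteSpace H]
  {J C : H →L[ℂ] H} {S A : H →ₗ.[ℂ] H}

theorem IsFundamentalSymmetry.apply_apply (hJ : IsFundamentalSymmetry J) (x : H) :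
    J (J x) = x :=
  congrArg (fun T : H →L[ℂ] H => T x) hJ.sq

theorem HasCSymmetry.apply_apply (hC : HasCSymmetry J A C) (x : H) : C (C x) = x :=
  congrArg (fun T : H →L[ℂ] H => T x) hC.sq

theorem HasCSymmetry.graphInvariant (hC : HasCSymmetry J A C) : GraphInvariant C A :=
  (commutes_iff_graphInvariant hC.sq).1 hC.comm

theorem IsFundamentalSymmetry.hasCSymmetry (hJ : IsFundamentalSymmetry J) (h : Commutes S J) :
    HasCSymmetry J S J where
  sq := hJ.sq
  selfAdjoint := by
    rw [hJ.sq]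
    exact IsSelfAdjoint.one _
  pos x hx := by
    have h : (⟪x, x⟫_ℂ).re = ‖x‖ ^ 2 := inner_self_eq_norm_sq (𝕜 := ℂ) x
    rw [hJ.apply_apply, h]
    exact pow_pos (norm_pos_iff.2 hx) 2
  comm := h

/-- Self-adjointness of `J C` reads `C* J = J C`; multiply by `J` on the right. -/
theorem HasCSymmetry.adjoint_eq (hJ : IsFundamentalSymmetry J) (hC : HasCSymmetry J S C) :
    ContinuousLinearMap.adjoint C = J ∘L C ∘L J := by
  have hJ' : ContinuousLinearMap.adjoint J = J := hJ.selfAdjoint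
  have h : ContinuousLinearMap.adjoint (J ∘L C) = J ∘L C := hC.selfAdjoint
  rw [ContinuousLinearMap.adjoint_comp, hJ'] at h
  ext x
  have := congrArg (fun T : H →L[ℂ] H => T (J x)) h
  simpa [hJ.apply_apply] using this

theorem HasCSymmetry.graphInvariant_adjoint (hJ : IsFundamentalSymmetry J)
    (hSJ : Commutes S J) (hC : HasCSymmetry J S C) :
    GraphInvariant (ContinuousLinearMap.adjoint C) S := by
  have h := (hJ.hasCSymmetry hSJ).graphInvariant
  rw [hC.adjoint_eq hJ]
  exact h.comp (hC.graphInvariant.comp h)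

theorem HasCSymmetry.graphInvariant_graph_adjoint (hJ : IsFundamentalSymmetry J)
    (hS : IsSymm S) (hSJ : Commutes S J) (hC : HasCSymmetry J S C) :
    GraphInvariant C S.adjoint :=
  (hC.graphInvariant_adjoint hJ hSJ).adjoint hS.dense

/-- Since `J` is itself a `C`-symmetry of `S`, the elements of `Upsilon J S` are the self-adjoint
extensions of `S` that commute with every `C`-symmetry of `S`. -/
theorem mem_Upsilon_iff (hJ : IsFundamentalSymmetry J) (hSJ : Commutes S J) :
    A ∈ Upsilon J S ↔ S ≤ A ∧ IsSelfAdjoint A ∧ ∀ C, HasCSymmetry J S C → GraphInvariant C A := by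
  have hJC := hJ.hasCSymmetry hSJ
  have key : GraphInvariant J A →
      (compBounded A.adjoint J = boundedComp J A ↔ IsSelfAdjoint A) := by
    intro h
    -- With `J A = A J` the condition becomes `A* J = A J`, and the invertible `J` cancels.
    rw [LinearPMap.isSelfAdjoint_def, ← (commutes_iff_graphInvariant hJ.sq).2 h]
    constructor
    · intro h1
      refine LinearPMap.eq_of_eq_graph (Submodule.ext fun p => ?_)
      have h2 := congrArg (fun T : H →ₗ.[ℂ] H => (J p.1, p.2) ∈ T.graph) h1
      simpa only [mem_graph_compBounded, hJ.apply_apply, eq_iff_iff] using h2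
    · intro h1
      rw [h1]
  constructor
  · rintro ⟨⟨hSA, hA⟩, hcomm⟩
    have hinv : ∀ C, HasCSymmetry J S C → GraphInvariant C A := fun C hC =>
      (commutes_iff_graphInvariant hC.sq).1 (hcomm C hC)
    exact ⟨hSA, (key (hinv J hJC)).1 hA, hinv⟩
  · rintro ⟨hSA, hA, hinv⟩
    exact ⟨⟨hSA, (key (hinv J hJC)).2 hA⟩,
      fun C hC => (commutes_iff_graphInvariant hC.sq).2 (hinv C hC)⟩

/-- The operator `J C` and its inverse `C J` preserve the graph of `A`, so `(y, z)` lies in it iff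
`(J C y, J C z)` does. Testing the latter against `A = A*` is exactly the adjoint condition for the
new inner product. Density carries over because the new form is continuous in the norm of `H`. -/
theorem isSelfAdjointFor_of_graphInvariant (hJ : IsFundamentalSymmetry J)
    (hA : IsSelfAdjoint A) (hAJ : GraphInvariant J A) (hC : HasCSymmetry J S C)
    (hAC : GraphInvariant C A) : IsSelfAdjointFor hC.core A := by
  constructor
  · intro x ε hε
    have hc : Continuous fun d : H => (⟪x - d, J (C (x - d))⟫_ℂ).re := by fun_prop
    have hopen : IsOpen {d : H | (⟪x - d, J (C (x - d))⟫_ℂ).re < ε} :=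
      isOpen_lt hc continuous_const
    obtain ⟨d, hd, hd'⟩ := hA.dense_domain.exists_mem_open hopen ⟨x, by simpa using hε⟩
    exact ⟨d, hd, hd'⟩
  · have hG : ∀ u v : H, ⟪u, J (C v)⟫_ℂ = ⟪J (C u), v⟫_ℂ := fun u v =>
      (hC.selfAdjoint.isSymmetric u v).symm
    intro y z
    have h1 : (y, z) ∈ A.graph ↔ (J (C y), J (C z)) ∈ A.graph := by
      refine ⟨fun h => hAJ _ _ (hAC _ _ h), fun h => ?_⟩
      simpa [hJ.apply_apply, hC.apply_apply] using hAC _ _ (hAJ _ _ h)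
    rw [h1, mem_graph_iff_of_isSelfAdjoint hA]
    constructor
    · intro h x
      exact (hG _ _).trans ((h _ _ (A.mem_graph x)).trans (hG _ _).symm)
    · intro h a b hab
      obtain ⟨x, hx, hx'⟩ := (LinearPMap.mem_graph_iff A).1 hab
      simp only at hx hx'
      subst hx hx'
      exact (hG _ _).symm.trans ((h x).trans (hG _ _))

end Symmetries

/-! ### The extension attached to a real point of regular type -/

section Regular

variable {H : Type*} [NormedAddCommGroup H] [InnerProductSpace ℂ H] [CompleteSpace H]
  {S : H →ₗ.[ℂ] H}

/-- The graph of a closed `S` is complete, and `(x, y) ↦ y - r x` is bounded below on it. -/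
theorem isClosed_range_sub_of_isRegularTypePoint (hcl : S.IsClosed) {r : ℝ}
    (hr : IsRegularTypePoint S r) :
    IsClosed ((S.graph.map (LinearMap.snd ℂ H H - (r : ℂ) • LinearMap.fst ℂ H H) :
      Submodule ℂ H) : Set H) := by
  obtain ⟨k, hk, h⟩ := hr
  let T : H × H →L[ℂ] H := ContinuousLinearMap.snd ℂ H H - (r : ℂ) • ContinuousLinearMap.fst ℂ H H
  let f : S.graph →L[ℂ] H := T ∘L S.graph.subtypeL
  have hcomp : CompleteSpace S.graph := IsClosed.completeSpace_coe (hs := hcl)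
  -- `k⁻¹` bounds `x` and `1 + |r| k⁻¹` bounds `S x`; their sum bounds the sup norm.
  have hb : ∀ p : S.graph, ‖p‖ ≤ (k⁻¹ + (1 + |r| * k⁻¹)) * ‖f p‖ := by
    rintro ⟨⟨x, y⟩, hp⟩
    obtain ⟨u, hu, hu'⟩ := (LinearPMap.mem_graph_iff S).1 hp
    simp only at hu hu'
    subst hu hu'
    have hf : f ⟨((u : H), S u), hp⟩ = S u - (r : ℂ) • (u : H) := rfl
    have h1 : ‖(u : H)‖ ≤ k⁻¹ * ‖f ⟨((u : H), S u), hp⟩‖ := by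
      rw [hf, inv_mul_eq_div, le_div_iff₀ hk, mul_comm]
      exact h u
    have h2 : ‖S u‖ ≤ (1 + |r| * k⁻¹) * ‖f ⟨((u : H), S u), hp⟩‖ := by
      have e : S u = f ⟨((u : H), S u), hp⟩ + (r : ℂ) • (u : H) := by rw [hf]; abel
      have h3 := norm_add_le (f ⟨((u : H), S u), hp⟩) ((r : ℂ) • (u : H))
      rw [← e, norm_smul, Complex.norm_real, Real.norm_eq_abs] at h3
      nlinarith [mul_le_mul_of_nonneg_left h1 (abs_nonneg r)]
    have h0 := norm_nonneg (f ⟨((u : H), S u), hp⟩)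
    change max ‖(u : H)‖ ‖S u‖ ≤ _
    refine max_le ?_ ?_
    · nlinarith [mul_nonneg (mul_nonneg (abs_nonneg r) (inv_pos.2 hk).le) h0]
    · nlinarith [mul_nonneg (inv_pos.2 hk).le h0]
  have hanti : AntilipschitzWith (Real.toNNReal (k⁻¹ + (1 + |r| * k⁻¹))) f := by
    refine ContinuousLinearMap.antilipschitz_of_bound f fun p => ?_
    rw [Real.coe_toNNReal _ (by positivity)]
    exact hb p
  have hrange := hanti.isClosed_range f.uniformContinuous
  convert hrange using 1
  ext y
  simp only [SetLike.mem_coe, Submodule.mem_map, Set.mem_range, Subtype.exists]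
  exact ⟨fun ⟨p, hp, e⟩ => ⟨p, hp, e⟩, fun ⟨p, hp, e⟩ => ⟨p, hp, e⟩⟩

theorem mem_graph_regularExtension_iff (hS : IsSymm S) {r : ℝ} {x y : H} :
    (x, y) ∈ (regularExtension S r).graph ↔
      ∃ s t k, (s, t) ∈ S.graph ∧ (k, (r : ℂ) • k) ∈ S.adjoint.graph ∧
        x = s + k ∧ y = t + (r : ℂ) • k := by
  rw [regularExtension, mem_graph_domRestrict, Submodule.mem_sup]
  constructor
  · rintro ⟨⟨s, hs, k, hk, rfl⟩, hxy⟩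
    have hs' := S.mem_graph ⟨s, hs⟩
    refine ⟨s, _, k, hs', mem_kerSub.1 hk, rfl, ?_⟩
    exact LinearPMap.mem_graph_snd_inj _ hxy
      (Submodule.add_mem _ (hS.graph_adjoint hs') (mem_kerSub.1 hk)) rfl
  · rintro ⟨s, t, k, hs, hk, rfl, rfl⟩
    exact ⟨⟨s, LinearPMap.mem_domain_of_mem_graph hs, k, mem_kerSub.2 hk, rfl⟩,
      Submodule.add_mem _ (hS.graph_adjoint hs) hk⟩

theorem le_regularExtension (hS : IsSymm S) (r : ℝ) : S ≤ regularExtension S r := by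
  refine LinearPMap.le_of_le_graph fun p hp => ?_
  exact (mem_graph_regularExtension_iff hS).2
    ⟨p.1, p.2, 0, hp, by simp, by simp, by simp⟩

/-- For maximality, pairing `(y, z)` with `ker (S* - r)` shows that `z - r y` is orthogonal to that
kernel, hence lies in the closed range of `S - r`. If it equals `t - r s` with `(s, t)` in the graph
of `S`, then `y - s` is in the kernel. -/
theorem isSelfAdjoint_regularExtension (hS : IsSymm S) (hcl : S.IsClosed) {r : ℝ}
    (hr : IsRegularTypePoint S r) : IsSelfAdjoint (regularExtension S r) := by
  have hle := le_regularExtension hS r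
  refine isSelfAdjoint_of_graph (hS.dense.mono hle.1) ?_ ?_
  · intro x y a b hxy hab
    obtain ⟨s, t, k, hs, hk, rfl, rfl⟩ := (mem_graph_regularExtension_iff hS).1 hxy
    obtain ⟨s', t', k', hs', hk', rfl, rfl⟩ := (mem_graph_regularExtension_iff hS).1 hab
    have h1 := hS.inner_graph hs hs'
    have h2 := (mem_graph_adjoint_iff hS.dense).1 hk _ _ hs'
    have h3 := congrArg conj ((mem_graph_adjoint_iff hS.dense).1 hk' _ _ hs)
    simp only [map_mul, inner_conj_symm, inner_smul_left, inner_smul_right, inner_add_left,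
      inner_add_right, Complex.conj_ofReal] at h1 h2 h3 ⊢
    rw [h1, h2, h3]
    ring
  · intro y z hyz
    have hyz' : (y, z) ∈ S.adjoint.graph := (mem_graph_adjoint_iff hS.dense).2
      fun a b hab => hyz a b (LinearPMap.le_graph_of_le hle hab)
    let R : Submodule ℂ H :=
      S.graph.map (LinearMap.snd ℂ H H - (r : ℂ) • LinearMap.fst ℂ H H)
    have hR : IsClosed (R : Set H) := isClosed_range_sub_of_isRegularTypePoint hcl hr
    have : CompleteSpace R := hR.completeSpace_coe
    have hmem : z - (r : ℂ) • y ∈ R := by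
      rw [← R.orthogonal_orthogonal, Submodule.mem_orthogonal']
      intro k hk
      have hk' : (k, (r : ℂ) • k) ∈ S.adjoint.graph := by
        rw [mem_graph_adjoint_iff hS.dense]
        intro a b hab
        have h1 := (Submodule.mem_orthogonal' _ _).1 hk (b - (r : ℂ) • a) ⟨(a, b), hab, rfl⟩
        rw [inner_sub_right, inner_smul_right, sub_eq_zero] at h1
        rw [h1, inner_smul_left, Complex.conj_ofReal]
      have h2 := hyz k ((r : ℂ) • k) ((mem_graph_regularExtension_iff hS).2
        ⟨0, 0, k, S.graph.zero_mem, hk', by simp, by simp⟩)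
      rw [inner_sub_left, inner_smul_left, Complex.conj_ofReal, ← h2, inner_smul_right, sub_self]
    obtain ⟨⟨s, t⟩, hst, e⟩ := hmem
    replace e : t - (r : ℂ) • s = z - (r : ℂ) • y := e
    have e2 : (r : ℂ) • (y - s) = z - t := by
      rw [smul_sub, sub_eq_sub_iff_add_eq_add, add_comm, ← sub_eq_sub_iff_add_eq_add.1 e]
    refine (mem_graph_regularExtension_iff hS).2 ⟨s, t, y - s, hst, ?_, by abel, ?_⟩
    · rw [e2]
      exact Submodule.sub_mem _ hyz' (hS.graph_adjoint hst)
    · rw [e2]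
      abel

theorem GraphInvariant.regularExtension (hS : IsSymm S) {C : H →L[ℂ] H}
    (hC : GraphInvariant C S) (hC' : GraphInvariant C S.adjoint) (r : ℝ) :
    GraphInvariant C (regularExtension S r) := by
  intro x y hxy
  obtain ⟨s, t, k, hs, hk, rfl, rfl⟩ := (mem_graph_regularExtension_iff hS).1 hxy
  refine (mem_graph_regularExtension_iff hS).2 ⟨C s, C t, C k, hC _ _ hs, ?_, by simp, by simp⟩
  simpa using hC' _ _ hk

end Regular

/-! ### A transversal self-adjoint extension -/

section Transversal

variable {H : Type*} [NormedAddCommGroup H] [InnerProductSpace ℂ H] [CompleteSpace H]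
  {S A : H →ₗ.[ℂ] H}

/-- The pairs `(g, -f)` in the graph of `S*` for which `(f, g)` is in the graph of `A`. For `A`
self-adjoint, the pairs `(f, g)` make up the orthogonal complement of the graph of `S` in the graph
of `A`. -/
def rotatedComplement (S A : H →ₗ.[ℂ] H) : Submodule ℂ (H × H) :=
  S.adjoint.graph ⊓
    A.graph.comap ((-LinearMap.snd ℂ H H).prod (LinearMap.fst ℂ H H))

theorem mem_rotatedComplement {p : H × H} :
    p ∈ rotatedComplement S A ↔ p ∈ S.adjoint.graph ∧ (-p.2, p.1) ∈ A.graph := Iff.rfl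

/-- The restriction of `S*` whose graph is the sum of the graph of `S` and the rotated orthogonal
complement of the graph of `S` in the graph of `A`. -/
def transversalExtension (S A : H →ₗ.[ℂ] H) : H →ₗ.[ℂ] H :=
  S.adjoint.domRestrict
    (S.domain ⊔ (rotatedComplement S A).map (LinearMap.fst ℂ H H))

theorem graph_transversalExtension (hS : IsSymm S) :
    (transversalExtension S A).graph = S.graph ⊔ rotatedComplement S A := by
  ext ⟨x, y⟩
  rw [transversalExtension, mem_graph_domRestrict, Submodule.mem_sup, Submodule.mem_sup]
  constructor
  · rintro ⟨⟨s, hs, _, ⟨⟨g, f⟩, hg, rfl⟩, rfl⟩, hxy⟩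
    have hs' := S.mem_graph ⟨s, hs⟩
    refine ⟨_, hs', _, hg, Prod.ext rfl ?_⟩
    exact (LinearPMap.mem_graph_snd_inj _ hxy
      (Submodule.add_mem _ (hS.graph_adjoint hs') hg.1) rfl).symm
  · rintro ⟨⟨s, t⟩, hs, ⟨g, f⟩, hg, e⟩
    rw [← e]
    obtain ⟨rfl, rfl⟩ := Prod.mk.inj e
    exact ⟨⟨s, LinearPMap.mem_domain_of_mem_graph hs, g, ⟨_, hg, rfl⟩, rfl⟩,
      Submodule.add_mem _ (hS.graph_adjoint hs) hg.1⟩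

theorem le_transversalExtension (hS : IsSymm S) : S ≤ transversalExtension S A :=
  LinearPMap.le_of_le_graph ((graph_transversalExtension hS).symm ▸ le_sup_left)

/-- A pair in the graph of `A` that is orthogonal to the orthogonal complement of the graph of `S`
in the graph of `A` is in the graph of `S`. -/
theorem mem_graph_of_forall_rotatedComplement (hS : IsSymm S) (hcl : S.IsClosed) (hSA : S ≤ A)
    {a b : H} (hab : (a, b) ∈ A.graph)
    (h : ∀ p ∈ rotatedComplement S A, ⟪a, p.2⟫_ℂ = ⟪b, p.1⟫_ℂ) : (a, b) ∈ S.graph := by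
  obtain ⟨q, hq, horth⟩ := exists_decomp_of_isClosed hcl (a, b)
  have hmn : (a - q.1, b - q.2) ∈ A.graph :=
    Submodule.sub_mem _ hab (LinearPMap.le_graph_of_le hSA hq)
  -- The remainder `(a, b) - q` is in `A` and orthogonal to the graph of `S`, so its rotation is an
  -- admissible test pair. The hypothesis then makes the remainder orthogonal to `(a, b)`, as it
  -- already is to `q`, hence to itself.
  have hmem : (b - q.2, -(a - q.1)) ∈ rotatedComplement S A := by
    refine mem_rotatedComplement.2 ⟨?_, by simpa using hmn⟩
    rw [mem_graph_adjoint_iff hS.dense]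
    intro s t hst
    have := horth _ hst
    simp only at this
    rw [inner_neg_left, eq_neg_iff_add_eq_zero, add_comm]
    exact this
  have h1 := h _ hmem
  have h2 := horth _ hq
  simp only [inner_neg_right] at h1 h2
  have h3 : ⟪a - q.1, a - q.1⟫_ℂ + ⟪b - q.2, b - q.2⟫_ℂ = 0 := by
    have c2 := congrArg conj h2
    simp only [map_add, inner_conj_symm, map_zero] at c2
    have e1 : ⟪a - q.1, a - q.1⟫_ℂ = ⟪a, a - q.1⟫_ℂ - ⟪q.1, a - q.1⟫_ℂ := inner_sub_left _ _ _
    have e2 : ⟪b - q.2, b - q.2⟫_ℂ = ⟪b, b - q.2⟫_ℂ - ⟪q.2, b - q.2⟫_ℂ := inner_sub_left _ _ _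
    rw [e1, e2, ← h1]
    linear_combination -c2
  have h4 := congrArg Complex.re h3
  rw [inner_self_eq_norm_sq_to_K, inner_self_eq_norm_sq_to_K] at h4
  norm_cast at h4
  have h5 : ‖a - q.1‖ = 0 := by
    have h6 : ‖a - q.1‖ ^ 2 + ‖b - q.2‖ ^ 2 = 0 := by exact_mod_cast h4
    nlinarith [sq_nonneg ‖a - q.1‖, sq_nonneg ‖b - q.2‖]
  have h6 : a = q.1 := sub_eq_zero.1 (norm_eq_zero.1 h5)
  have h7 : b = q.2 := LinearPMap.mem_graph_snd_inj _ hab (LinearPMap.le_graph_of_le hSA hq) h6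
  rw [h6, h7]
  exact hq

/-- Project onto the closed graph of `A`. Orthogonality of the residual `(u, v)` to that graph says
that `(-v, u)` is in `A* = A`. -/
theorem exists_add_rotatedComplement (hS : IsSymm S) (hSA : S ≤ A) (hA : IsSelfAdjoint A)
    {p : H × H} (hp : p ∈ S.adjoint.graph) :
    ∃ q ∈ A.graph, p - q ∈ rotatedComplement S A := by
  obtain ⟨q, hq, horth⟩ := exists_decomp_of_isClosed hA.isClosed p
  have hAS : A.graph ≤ S.adjoint.graph := by
    intro w hw
    refine (mem_graph_adjoint_iff hS.dense).2 fun a b hab => ?_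
    exact (mem_graph_iff_of_isSelfAdjoint hA).1 hw a b (LinearPMap.le_graph_of_le hSA hab)
  refine ⟨q, hq, Submodule.sub_mem _ hp (hAS hq), ?_⟩
  refine (mem_graph_iff_of_isSelfAdjoint hA).2 fun a b hab => ?_
  have := horth _ hab
  change ⟪-(p.2 - q.2), b⟫_ℂ = ⟪p.1 - q.1, a⟫_ℂ
  rw [inner_neg_left]
  linear_combination -this

theorem inner_graph_transversalExtension (hS : IsSymm S) (hA : IsSelfAdjoint A) {p q : H × H}
    (hp : p ∈ (transversalExtension S A).graph) (hq : q ∈ (transversalExtension S A).graph) :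
    ⟪p.1, q.2⟫_ℂ = ⟪p.2, q.1⟫_ℂ := by
  rw [graph_transversalExtension hS, Submodule.mem_sup] at hp hq
  obtain ⟨s, hs, k, hk, rfl⟩ := hp
  obtain ⟨s', hs', k', hk', rfl⟩ := hq
  have h1 : ⟪s.1, s'.2⟫_ℂ = ⟪s.2, s'.1⟫_ℂ := hS.inner_graph hs hs'
  have h2 := (mem_graph_adjoint_iff hS.dense).1 hk.1 _ _ hs'
  have h3 := congrArg conj ((mem_graph_adjoint_iff hS.dense).1 hk'.1 _ _ hs)
  have h4 := (mem_graph_iff_of_isSelfAdjoint hA).1 hk.2 _ _ hk'.2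
  simp only [inner_conj_symm, LinearMap.fst_apply, LinearMap.snd_apply, LinearMap.neg_apply,
    inner_neg_left, inner_neg_right] at h3 h4
  simp only [Prod.fst_add, Prod.snd_add, inner_add_left, inner_add_right]
  linear_combination h1 + h2 - h3 + h4

theorem mem_graph_of_forall_transversalExtension (hS : IsSymm S) (hcl : S.IsClosed) (hSA : S ≤ A)
    {p : H × H} (hp : p ∈ A.graph)
    (h : ∀ q ∈ (transversalExtension S A).graph, ⟪p.1, q.2⟫_ℂ = ⟪p.2, q.1⟫_ℂ) : p ∈ S.graph :=
  mem_graph_of_forall_rotatedComplement hS hcl hSA hp fun q hq =>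
    h q (by rw [graph_transversalExtension hS]; exact (le_sup_right : _ ≤ S.graph ⊔ _) hq)

/-- Split a pair satisfying the adjoint condition as `q + k` with `q` in `A` and `k` rotated. Then
`q` satisfies the condition too, which forces it into the graph of `S`. -/
theorem isSelfAdjoint_transversalExtension (hS : IsSymm S) (hcl : S.IsClosed) (hSA : S ≤ A)
    (hA : IsSelfAdjoint A) : IsSelfAdjoint (transversalExtension S A) := by
  have hle : S ≤ transversalExtension S A := le_transversalExtension hS
  refine isSelfAdjoint_of_graph (hS.dense.mono hle.1)
    (fun x y a b h h' => inner_graph_transversalExtension hS hA h h') ?_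
  intro x y hxy
  have hxy' : (x, y) ∈ S.adjoint.graph := (mem_graph_adjoint_iff hS.dense).2
    fun a b hab => hxy a b (LinearPMap.le_graph_of_le hle hab)
  obtain ⟨q, hq, hk⟩ := exists_add_rotatedComplement hS hSA hA hxy'
  have hk' : (x, y) - q ∈ (transversalExtension S A).graph := by
    rw [graph_transversalExtension hS]
    exact (le_sup_right : _ ≤ S.graph ⊔ _) hk
  have hqS : q ∈ S.graph := by
    refine mem_graph_of_forall_transversalExtension hS hcl hSA hq fun w hw => ?_
    have h1 := hxy _ _ hw
    have h2 := inner_graph_transversalExtension hS hA hk' hw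
    simp only [Prod.fst_sub, Prod.snd_sub, inner_sub_left] at h2
    linear_combination h1 - h2
  rw [← sub_add_cancel (x, y) q]
  exact Submodule.add_mem _ hk' (LinearPMap.le_graph_of_le hle hqS)

theorem transversal_transversalExtension (hS : IsSymm S) (hcl : S.IsClosed) (hSA : S ≤ A)
    (hA : IsSelfAdjoint A) : Transversal S A (transversalExtension S A) := by
  have hle : S ≤ transversalExtension S A := le_transversalExtension hS
  have hAS : A ≤ S.adjoint := by
    refine LinearPMap.le_of_le_graph fun w hw => ?_
    refine (mem_graph_adjoint_iff hS.dense).2 fun a b hab => ?_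
    exact (mem_graph_iff_of_isSelfAdjoint hA).1 hw a b (LinearPMap.le_graph_of_le hSA hab)
  have hTS : transversalExtension S A ≤ S.adjoint := LinearPMap.domRestrict_le
  constructor
  · refine le_antisymm ?_ (le_inf hSA.1 hle.1)
    rintro x ⟨hx, hx'⟩
    have h1 := A.mem_graph ⟨x, hx⟩
    have h2 := (transversalExtension S A).mem_graph ⟨x, hx'⟩
    have e := LinearPMap.mem_graph_snd_inj _ (LinearPMap.le_graph_of_le hAS h1)
      (LinearPMap.le_graph_of_le hTS h2) rfl
    rw [← e] at h2
    exact LinearPMap.mem_domain_of_mem_graph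
      (mem_graph_of_forall_transversalExtension hS hcl hSA h1
        fun w hw => inner_graph_transversalExtension hS hA h2 hw)
  · refine le_antisymm (sup_le hAS.1 hTS.1) fun x hx => ?_
    obtain ⟨q, hq, hk⟩ := exists_add_rotatedComplement hS hSA hA (S.adjoint.mem_graph ⟨x, hx⟩)
    have hk' : ((x, S.adjoint ⟨x, hx⟩) : H × H) - q ∈ (transversalExtension S A).graph := by
      rw [graph_transversalExtension hS]
      exact (le_sup_right : _ ≤ S.graph ⊔ _) hk
    refine Submodule.mem_sup.2 ⟨q.1, LinearPMap.mem_domain_of_mem_graph hq, x - q.1,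
      LinearPMap.mem_domain_of_mem_graph hk', by abel⟩

/-- A non-unitary `C` need not respect orthogonality in `H × H`, but the rotated complement is cut
out by membership in the graphs of `S*` and `A` alone, both of which `C` preserves. -/
theorem GraphInvariant.transversalExtension (hS : IsSymm S) {C : H →L[ℂ] H}
    (hC : GraphInvariant C S) (hC' : GraphInvariant C S.adjoint) (hCA : GraphInvariant C A) :
    GraphInvariant C (transversalExtension S A) := by
  intro x y hxy
  rw [graph_transversalExtension hS, Submodule.mem_sup] at hxy ⊢
  obtain ⟨s, hs, k, hk, e⟩ := hxy
  obtain ⟨rfl, rfl⟩ := Prod.mk.inj e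
  refine ⟨(C s.1, C s.2), hC _ _ hs, (C k.1, C k.2),
    mem_rotatedComplement.2 ⟨hC' _ _ hk.1, ?_⟩, by simp⟩
  simpa using hCA _ _ hk.2

end Transversal

/-! ### Semi-inner products -/

section Core

variable {V : Type*} [AddCommGroup V] [Module ℂ V]

/-- Both iterated limits equal the inner product, in the completion, of the limits of the two Cauchy
sequences. -/
theorem tendsto_completion_of_core (c : PreInnerProductSpace.Core ℂ V) {h k : ℕ → V}
    (hh : Filter.Tendsto (fun p : ℕ × ℕ => (c.inner (h p.1 - h p.2) (h p.1 - h p.2)).re)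
      Filter.atTop (𝓝 0))
    (hk : Filter.Tendsto (fun p : ℕ × ℕ => (c.inner (k p.1 - k p.2) (k p.1 - k p.2)).re)
      Filter.atTop (𝓝 0))
    {f g : ℕ → ℂ} (hf : ∀ n, Filter.Tendsto (fun m => c.inner (h m) (k n)) Filter.atTop (𝓝 (f n)))
    (hg : ∀ m, Filter.Tendsto (fun n => c.inner (h m) (k n)) Filter.atTop (𝓝 (g m)))
    {a b : ℂ} (ha : Filter.Tendsto f Filter.atTop (𝓝 a))
    (hb : Filter.Tendsto g Filter.atTop (𝓝 b)) : a = b := by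
  let : SeminormedAddCommGroup V := InnerProductSpace.Core.toSeminormedAddCommGroup (c := c)
  let : InnerProductSpace ℂ V := InnerProductSpace.ofCore c
  have hlim : ∀ {u : ℕ → V}, Filter.Tendsto
      (fun p : ℕ × ℕ => (c.inner (u p.1 - u p.2) (u p.1 - u p.2)).re) Filter.atTop (𝓝 0) →
      ∃ w, Filter.Tendsto (fun n => (u n : UniformSpace.Completion V)) Filter.atTop (𝓝 w) := by
    intro u hu
    refine cauchySeq_tendsto_of_complete (cauchySeq_iff_tendsto_dist_atTop_0.2 ?_)
    have hs := (Real.continuous_sqrt.tendsto 0).comp hu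
    rw [Real.sqrt_zero] at hs
    refine hs.congr fun p => ?_
    rw [UniformSpace.Completion.dist_eq, dist_eq_norm]
    rfl
  obtain ⟨w, hw⟩ := hlim hh
  obtain ⟨v, hv⟩ := hlim hk
  have hf' : ∀ n, f n = ⟪w, (k n : UniformSpace.Completion V)⟫_ℂ := fun n =>
    tendsto_nhds_unique (hf n) ((hw.inner tendsto_const_nhds).congr
      fun m => UniformSpace.Completion.inner_coe (h m) (k n))
  have hg' : ∀ m, g m = ⟪(h m : UniformSpace.Completion V), v⟫_ℂ := fun m =>
    tendsto_nhds_unique (hg m) ((tendsto_const_nhds.inner hv).congr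
      fun n => UniformSpace.Completion.inner_coe (h m) (k n))
  have h1 : Filter.Tendsto f Filter.atTop (𝓝 ⟪w, v⟫_ℂ) :=
    (tendsto_const_nhds.inner hv).congr fun n => (hf' n).symm
  have h2 : Filter.Tendsto g Filter.atTop (𝓝 ⟪w, v⟫_ℂ) :=
    (hw.inner tendsto_const_nhds).congr fun n => (hg' n).symm
  exact (tendsto_nhds_unique ha h1).trans (tendsto_nhds_unique h2 hb)

/-- Riesz representation for a semi-inner product that need not be complete: the representing
vector is replaced by a Cauchy sequence. -/
theorem exists_seq_of_core (c : PreInnerProductSpace.Core ℂ V) (l : V →ₗ[ℂ] ℂ) (K : ℝ)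
    (hl : ∀ v, ‖l v‖ ≤ K * √(c.inner v v).re) :
    ∃ h : ℕ → V,
      Filter.Tendsto (fun p : ℕ × ℕ => (c.inner (h p.1 - h p.2) (h p.1 - h p.2)).re)
        Filter.atTop (𝓝 0) ∧
      ∀ v, Filter.Tendsto (fun n => c.inner (h n) v) Filter.atTop (𝓝 (l v)) := by
  let : SeminormedAddCommGroup V := InnerProductSpace.Core.toSeminormedAddCommGroup (c := c)
  let : InnerProductSpace ℂ V := InnerProductSpace.ofCore c
  let L : V →L[ℂ] ℂ := l.mkContinuous K hl
  let e : V →L[ℂ] UniformSpace.Completion V := UniformSpace.Completion.toComplL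
  let L' : StrongDual ℂ (UniformSpace.Completion V) := L.extend e
  have hL' : ∀ v : V, L' v = l v := fun v =>
    ContinuousLinearMap.extend_eq L (UniformSpace.Completion.denseRange_coe)
      (UniformSpace.Completion.isUniformInducing_coe V) v
  let w := (InnerProductSpace.toDual ℂ (UniformSpace.Completion V)).symm L'
  obtain ⟨x, hx, hxw⟩ := mem_closure_iff_seq_limit.1
    (UniformSpace.Completion.denseRange_coe (α := V) w)
  choose h hh using hx
  have hlim : Filter.Tendsto (fun n => (h n : UniformSpace.Completion V)) Filter.atTop (𝓝 w) :=
    hxw.congr fun n => (hh n).symm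
  refine ⟨h, ?_, fun v => ?_⟩
  · have h1 := (cauchySeq_iff_tendsto_dist_atTop_0.1 hlim.cauchySeq).pow 2
    rw [zero_pow two_ne_zero] at h1
    refine h1.congr fun p => ?_
    rw [UniformSpace.Completion.dist_eq, dist_eq_norm]
    exact (inner_self_eq_norm_sq (𝕜 := ℂ) _).symm
  · have h1 : Filter.Tendsto (fun n => ⟪(h n : UniformSpace.Completion V),
        (v : UniformSpace.Completion V)⟫_ℂ) Filter.atTop
        (𝓝 ⟪w, (v : UniformSpace.Completion V)⟫_ℂ) := hlim.inner tendsto_const_nhds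
    rw [InnerProductSpace.toDual_symm_apply, hL'] at h1
    exact h1.congr fun n => UniformSpace.Completion.inner_coe _ _

end Core

/-! ### Nonnegative symmetric linear relations -/

section Relation

variable {H : Type*} [NormedAddCommGroup H] [InnerProductSpace ℂ H]

/-- A nonnegative symmetric linear relation. -/
structure IsNonnegRel (R : Submodule ℂ (H × H)) : Prop where
  symm : ∀ p ∈ R, ∀ q ∈ R, ⟪p.1, q.2⟫_ℂ = ⟪p.2, q.1⟫_ℂ
  nonneg : ∀ p ∈ R, 0 ≤ (⟪p.1, p.2⟫_ℂ).re

variable {R : Submodule ℂ (H × H)}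

/-- The semi-inner product `(x, y')` of pairs `(x, y)`, `(x', y')` of a nonnegative symmetric
relation. -/
@[reducible]
def IsNonnegRel.formCore (hR : IsNonnegRel R) : PreInnerProductSpace.Core ℂ R where
  inner p q := ⟪(p : H × H).1, (q : H × H).2⟫_ℂ
  conj_inner_symm p q := by
    rw [inner_conj_symm]
    exact (hR.symm p p.2 q q.2).symm
  re_inner_nonneg p := hR.nonneg p p.2
  add_left p q r := inner_add_left _ _ _
  smul_left p q r := inner_smul_left _ _ _

/-- The semi-inner product `(x, x') + (x, y')` of pairs `(x, y)`, `(x', y')` of a nonnegative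
symmetric relation. -/
@[reducible]
def IsNonnegRel.energyCore (hR : IsNonnegRel R) : PreInnerProductSpace.Core ℂ R where
  inner p q := ⟪(p : H × H).1, (q : H × H).1⟫_ℂ + ⟪(p : H × H).1, (q : H × H).2⟫_ℂ
  conj_inner_symm p q := by
    rw [map_add, inner_conj_symm, inner_conj_symm]
    exact congrArg _ (hR.symm p p.2 q q.2).symm
  re_inner_nonneg p := by
    rw [map_add]
    exact add_nonneg inner_self_nonneg (hR.nonneg p p.2)
  add_left p q r := by
    simp only [Submodule.coe_add, Prod.fst_add, inner_add_left]
    ring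
  smul_left p q r := by
    simp only [Submodule.coe_smul, Prod.smul_fst, inner_smul_left]
    ring

/-- The sequence `h` of pairs `(x, y)` is Cauchy for the quadratic form `(y, x)`. -/
def PairFormCauchy (h : ℕ → H × H) : Prop :=
  Filter.Tendsto (fun p : ℕ × ℕ => (⟪(h p.1 - h p.2).1, (h p.1 - h p.2).2⟫_ℂ).re)
    Filter.atTop (𝓝 0)

/-- The Friedrichs extension of a nonnegative symmetric linear relation `R`: the pairs `(x, y)` in
the adjoint of `R` with `x` in the domain of the closure of the form of `R`. -/
def friedrichsRel (R : Submodule ℂ (H × H)) : Set (H × H) :=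
  {p | (∀ q ∈ R, ⟪p.1, q.2⟫_ℂ = ⟪p.2, q.1⟫_ℂ) ∧
    ∃ h : ℕ → H × H, (∀ n, h n ∈ R) ∧
      Filter.Tendsto (fun n => (h n).1) Filter.atTop (𝓝 p.1) ∧ PairFormCauchy h}

theorem IsNonnegRel.mem_friedrichsRel (hR : IsNonnegRel R) {p : H × H}
    (hp : p ∈ R) : p ∈ friedrichsRel R :=
  ⟨fun q hq => hR.symm p hp q hq, fun _ => p, fun _ => hp, tendsto_const_nhds, by
    simp [PairFormCauchy]⟩

/-- The two sides are the iterated limits of the form along approximating sequences of `p` and `q`.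
-/
theorem IsNonnegRel.inner_friedrichsRel (hR : IsNonnegRel R) {p q : H × H}
    (hp : p ∈ friedrichsRel R) (hq : q ∈ friedrichsRel R) : ⟪p.1, q.2⟫_ℂ = ⟪p.2, q.1⟫_ℂ := by
  obtain ⟨hp', h, hhR, hhp, hhc⟩ := hp
  obtain ⟨hq', k, hkR, hkq, hkc⟩ := hq
  have hq'' : ∀ r ∈ R, ⟪r.2, q.1⟫_ℂ = ⟪r.1, q.2⟫_ℂ := fun r hr => by
    rw [← inner_conj_symm, hq' r hr, inner_conj_symm]
  have key := tendsto_completion_of_core hR.formCore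
    (h := fun n => ⟨h n, hhR n⟩) (k := fun n => ⟨k n, hkR n⟩) hhc hkc
    (f := fun n => ⟪p.2, (k n).1⟫_ℂ) (g := fun m => ⟪(h m).1, q.2⟫_ℂ)
    (a := ⟪p.2, q.1⟫_ℂ) (b := ⟪p.1, q.2⟫_ℂ) ?_ ?_
    (tendsto_const_nhds.inner hkq) (hhp.inner tendsto_const_nhds)
  · exact key.symm
  · intro n
    rw [← hp' _ (hkR n)]
    exact hhp.inner tendsto_const_nhds
  · intro m
    rw [← hq'' _ (hhR m)]
    exact (tendsto_const_nhds.inner hkq).congr fun n => (hR.symm _ (hhR m) _ (hkR n)).symm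

theorem IsNonnegRel.sq_re_inner_le (hR : IsNonnegRel R) {p q : H × H} (hp : p ∈ R) (hq : q ∈ R) :
    (⟪p.1, q.2⟫_ℂ).re ^ 2 ≤ (⟪p.1, p.2⟫_ℂ).re * (⟪q.1, q.2⟫_ℂ).re := by
  have h1 := InnerProductSpace.Core.inner_mul_inner_self_le (c := hR.formCore) ⟨p, hp⟩ ⟨q, hq⟩
  have h2 := InnerProductSpace.Core.norm_inner_symm (c := hR.formCore) ⟨p, hp⟩ ⟨q, hq⟩
  rw [← h2] at h1
  refine le_trans ?_ h1
  have h3 : |(⟪p.1, q.2⟫_ℂ).re| ≤ ‖⟪p.1, q.2⟫_ℂ‖ := Complex.abs_re_le_norm _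
  rw [← sq_abs, sq]
  exact mul_self_le_mul_self (abs_nonneg _) h3

/-- Repeated squaring gives `a 0 * (a 1 / a 0) ^ 2 ^ k ≤ a (2 ^ k) ≤ K * M ^ 2 ^ k`, which fails for
large `k` if `a 1 / a 0 > M`. -/
theorem le_mul_of_sq_le_mul {a : ℕ → ℝ} {K M : ℝ} (hM : 0 < M) (h0 : 0 ≤ a 0)
    (hsq : ∀ n, a n ^ 2 ≤ a 0 * a (2 * n)) (hbound : ∀ n, a n ≤ K * M ^ n) :
    a 1 ≤ M * a 0 := by
  by_contra! hlt
  rcases h0.eq_or_lt with h0 | h0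
  · have := hsq 1
    rw [← h0, mul_zero] at hlt
    rw [← h0, zero_mul] at this
    nlinarith
  · have hρ : M < a 1 / a 0 := by rwa [lt_div_iff₀ h0]
    have hgrow : ∀ k : ℕ, a 0 * (a 1 / a 0) ^ 2 ^ k ≤ a (2 ^ k) := by
      intro k
      induction k with
      | zero => rw [pow_zero, pow_one, mul_div_cancel₀ _ h0.ne']
      | succ k ih =>
        have h1 := hsq (2 ^ k)
        have h2 : 0 ≤ a 0 * (a 1 / a 0) ^ 2 ^ k :=
          mul_nonneg h0.le (pow_nonneg (hM.trans hρ).le _)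
        have h3 := pow_le_pow_left₀ h2 ih 2
        have h4 : a 0 * (a 0 * (a 1 / a 0) ^ 2 ^ (k + 1)) ≤ a 0 * a (2 ^ (k + 1)) := by
          calc a 0 * (a 0 * (a 1 / a 0) ^ 2 ^ (k + 1)) = (a 0 * (a 1 / a 0) ^ 2 ^ k) ^ 2 := by
                rw [pow_succ 2 k, pow_mul]
                ring
            _ ≤ _ := h3.trans h1
            _ = _ := by rw [pow_succ' 2 k]
        exact le_of_mul_le_mul_left h4 h0
    have hr : 1 < a 1 / a 0 / M := by rwa [one_lt_div hM]
    have htend := (tendsto_pow_atTop_atTop_of_one_lt hr).comp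
      (tendsto_pow_atTop_atTop_of_one_lt (one_lt_two : (1 : ℕ) < 2))
    obtain ⟨k, hk⟩ := (htend.eventually_gt_atTop (K / a 0)).exists
    have h1 := (hgrow k).trans (hbound (2 ^ k))
    simp only [Function.comp_apply, div_pow _ M] at hk
    rw [div_lt_div_iff₀ h0 (by positivity)] at hk
    linarith

/-- Reid's inequality. -/
theorem IsNonnegRel.re_inner_le [CompleteSpace H] (hR : IsNonnegRel R) {T : H →L[ℂ] H}
    (hT : IsSelfAdjoint T) (hTR : ∀ p ∈ R, (T p.1, T p.2) ∈ R) {p : H × H} (hp : p ∈ R) :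
    (⟪T p.1, p.2⟫_ℂ).re ≤ (‖T‖ + 1) * (⟪p.1, p.2⟫_ℂ).re := by
  have hpow : ∀ n, ((T ^ n) p.1, (T ^ n) p.2) ∈ R := by
    intro n
    induction n with
    | zero => simpa using hp
    | succ n ih =>
      rw [pow_succ']
      exact hTR _ ih
  -- Cauchy–Schwarz for the form supplies the squaring hypothesis, since `(T ^ n x, T ^ n y) = (T ^
  -- (2 * n) x, y)`. The `+ 1` keeps `M` positive when `T = 0`.
  have h := le_mul_of_sq_le_mul (a := fun n => (⟪(T ^ n) p.1, p.2⟫_ℂ).re)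
    (K := ‖p.1‖ * ‖p.2‖) (M := ‖T‖ + 1) (by positivity) (by simpa using hR.nonneg p hp) ?_ ?_
  · simpa using h
  · intro n
    have h1 := hR.sq_re_inner_le (hpow n) hp
    have h2 : ⟪(T ^ n) p.1, (T ^ n) p.2⟫_ℂ = ⟪(T ^ (2 * n)) p.1, p.2⟫_ℂ := by
      rw [two_mul, pow_add]
      exact ((hT.pow n).isSymmetric _ _).symm
    rw [h2, mul_comm] at h1
    simpa using h1
  · intro n
    have h1 : ‖T ^ n‖ ≤ (‖T‖ + 1) ^ n := by
      rcases n.eq_zero_or_pos with rfl | hn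
      · rw [pow_zero, pow_zero]
        exact ContinuousLinearMap.norm_id_le
      · exact (norm_pow_le' T hn).trans
          (pow_le_pow_left₀ (norm_nonneg _) (by linarith) n)
    calc (⟪(T ^ n) p.1, p.2⟫_ℂ).re ≤ ‖(T ^ n) p.1‖ * ‖p.2‖ := re_inner_le_norm (𝕜 := ℂ) _ _
      _ ≤ ((‖T‖ + 1) ^ n * ‖p.1‖) * ‖p.2‖ := by
        gcongr
        exact ((T ^ n).le_opNorm _).trans (by gcongr)
      _ = _ := by ring

variable [CompleteSpace H]

theorem IsNonnegRel.map_mem_friedrichsRel (hR : IsNonnegRel R) {C : H →L[ℂ] H}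
    (hC : ∀ p ∈ R, (C p.1, C p.2) ∈ R)
    (hC' : ∀ p ∈ R, (ContinuousLinearMap.adjoint C p.1, ContinuousLinearMap.adjoint C p.2) ∈ R)
    {p : H × H} (hp : p ∈ friedrichsRel R) : (C p.1, C p.2) ∈ friedrichsRel R := by
  obtain ⟨hp', h, hhR, hhp, hhc⟩ := hp
  refine ⟨fun q hq => ?_, fun n => (C (h n).1, C (h n).2), fun n => hC _ (hhR n),
    (C.continuous.tendsto _).comp hhp, ?_⟩
  · have := hp' _ (hC' q hq)
    rwa [ContinuousLinearMap.adjoint_inner_right, ContinuousLinearMap.adjoint_inner_right] at this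
  -- The form at `(C x, C y)` is `(C* C x, y)`, which Reid's inequality bounds by a multiple of the
  -- form at `(x, y)`.
  · let T := ContinuousLinearMap.adjoint C ∘L C
    have hT : IsSelfAdjoint T := IsSelfAdjoint.star_mul_self C
    have hTR : ∀ q ∈ R, (T q.1, T q.2) ∈ R := fun q hq => hC' (C q.1, C q.2) (hC q hq)
    unfold PairFormCauchy at hhc ⊢
    have hlim := hhc.const_mul (‖T‖ + 1)
    rw [mul_zero] at hlim
    refine squeeze_zero (fun n => ?_) (fun n => ?_) hlim
    · exact hR.nonneg _ (R.sub_mem (hC _ (hhR n.1)) (hC _ (hhR n.2)))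
    · have h1 := hR.re_inner_le hT hTR (R.sub_mem (hhR n.1) (hhR n.2))
      refine le_trans (le_of_eq ?_) h1
      simp only [Prod.fst_sub, Prod.snd_sub, ← map_sub]
      rw [← ContinuousLinearMap.adjoint_inner_left]
      rfl

/-- Represent `x ↦ (z, x)` in the energy inner product by a Cauchy sequence. Its first components
converge to some `u`, and in the limit `(u, x + y) = (z, x)` on `R`, so `(u, z - u)` is in the
adjoint of `R`. -/
theorem IsNonnegRel.exists_add_eq (hR : IsNonnegRel R) (z : H) :
    ∃ p ∈ friedrichsRel R, p.1 + p.2 = z := by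
  let l : R →ₗ[ℂ] ℂ := (innerSL ℂ z : H →ₗ[ℂ] ℂ) ∘ₗ LinearMap.fst ℂ H H ∘ₗ R.subtype
  have hnorm : ∀ v : R, ‖(v : H × H).1‖ ^ 2 ≤ (hR.energyCore.inner v v).re := by
    intro v
    have h1 := hR.nonneg v v.2
    have h2 : (⟪(v : H × H).1, (v : H × H).1⟫_ℂ).re = ‖(v : H × H).1‖ ^ 2 :=
      inner_self_eq_norm_sq (𝕜 := ℂ) _
    refine le_of_le_of_eq ?_ (Complex.add_re _ _).symm
    linarith
  have hform : ∀ v : R, (⟪(v : H × H).1, (v : H × H).2⟫_ℂ).re ≤ (hR.energyCore.inner v v).re := by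
    intro v
    have h2 : (⟪(v : H × H).1, (v : H × H).1⟫_ℂ).re = ‖(v : H × H).1‖ ^ 2 :=
      inner_self_eq_norm_sq (𝕜 := ℂ) _
    refine le_of_le_of_eq ?_ (Complex.add_re _ _).symm
    nlinarith [sq_nonneg ‖(v : H × H).1‖]
  obtain ⟨h, hh, hl⟩ := exists_seq_of_core hR.energyCore l ‖z‖ fun v =>
    (norm_inner_le_norm z (v : H × H).1).trans
      (mul_le_mul_of_nonneg_left (Real.le_sqrt_of_sq_le (hnorm v)) (norm_nonneg z))
  have hcau : CauchySeq fun n => (h n : H × H).1 := by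
    refine cauchySeq_iff_tendsto_dist_atTop_0.2 ?_
    have hs := (Real.continuous_sqrt.tendsto 0).comp hh
    rw [Real.sqrt_zero] at hs
    refine squeeze_zero (fun p => dist_nonneg) (fun p => ?_) hs
    rw [dist_eq_norm]
    exact Real.le_sqrt_of_sq_le (hnorm (h p.1 - h p.2))
  obtain ⟨u, hu⟩ := cauchySeq_tendsto_of_complete hcau
  refine ⟨(u, z - u), ⟨fun q hq => ?_, fun n => h n, fun n => (h n).2, hu, ?_⟩, by simp⟩
  · have h1 : Filter.Tendsto (fun n => ⟪(h n : H × H).1, q.1⟫_ℂ + ⟪(h n : H × H).1, q.2⟫_ℂ)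
        Filter.atTop (𝓝 (⟪u, q.1⟫_ℂ + ⟪u, q.2⟫_ℂ)) :=
      (hu.inner tendsto_const_nhds).add (hu.inner tendsto_const_nhds)
    have h2 : ⟪u, q.1⟫_ℂ + ⟪u, q.2⟫_ℂ = ⟪z, q.1⟫_ℂ := tendsto_nhds_unique h1 (hl ⟨q, hq⟩)
    rw [inner_sub_left, ← h2]
    ring
  · exact squeeze_zero (fun p => hR.nonneg _ (h p.1 - h p.2).2)
      (fun p => hform (h p.1 - h p.2)) hh

/-- A symmetric relation whose sum with the identity is onto is maximal: choosing `f` with the same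
component sum as `p` gives `p - f = (w, -w)`, and pairing with `g` of component sum `w` gives `‖w‖²
= 0`. -/
theorem IsNonnegRel.mem_friedrichsRel_of_forall (hR : IsNonnegRel R) {p : H × H}
    (hp : ∀ q ∈ friedrichsRel R, ⟪p.1, q.2⟫_ℂ = ⟪p.2, q.1⟫_ℂ) : p ∈ friedrichsRel R := by
  obtain ⟨f, hf, hfp⟩ := hR.exists_add_eq (p.1 + p.2)
  obtain ⟨g, hg, hgw⟩ := hR.exists_add_eq (p.1 - f.1)
  have h1 := hp g hg
  have h2 := hR.inner_friedrichsRel hf hg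
  have e : p.2 - f.2 = -(p.1 - f.1) := by
    rw [neg_sub, sub_eq_sub_iff_add_eq_add, add_comm p.2, ← hfp]
  have h3 : ⟪p.1 - f.1, g.2⟫_ℂ = ⟪p.2 - f.2, g.1⟫_ℂ := by
    rw [inner_sub_left, inner_sub_left, h1, h2]
  rw [e, inner_neg_left, eq_neg_iff_add_eq_zero, ← inner_add_right, add_comm, hgw,
    inner_self_eq_zero] at h3
  rw [h3, neg_zero] at e
  rwa [show p = f from Prod.ext (sub_eq_zero.1 h3) (sub_eq_zero.1 e)]

end Relation

/-! ### The Friedrichs and Krein-von Neumann extensions of a nonnegative operator -/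

section Nonneg

variable {H : Type*} [NormedAddCommGroup H] [InnerProductSpace ℂ H] {S : H →ₗ.[ℂ] H}

theorem IsSymm.isNonnegRel_graph (hS : IsSymm S) (hpos : IsNonneg S) : IsNonnegRel S.graph where
  symm _ hp _ hq := hS.inner_graph hp hq
  nonneg p hp := by
    obtain ⟨x, hx⟩ := (LinearPMap.mem_graph_iff' S).1 hp
    rw [← hx]
    exact hpos x

/-- The inverse of `S` as a linear relation. -/
def inverseGraph (S : H →ₗ.[ℂ] H) : Submodule ℂ (H × H) :=
  S.graph.comap (LinearEquiv.prodComm ℂ H H : H × H →ₗ[ℂ] H × H)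

theorem mem_inverseGraph {p : H × H} : p ∈ inverseGraph S ↔ (p.2, p.1) ∈ S.graph := Iff.rfl

theorem IsSymm.isNonnegRel_inverseGraph (hS : IsSymm S) (hpos : IsNonneg S) :
    IsNonnegRel (inverseGraph S) where
  symm _ hp _ hq := (hS.inner_graph (mem_inverseGraph.1 hp) (mem_inverseGraph.1 hq)).symm
  nonneg p hp := by
    have h : 0 ≤ (⟪p.2, p.1⟫_ℂ).re := (hS.isNonnegRel_graph hpos).nonneg _ (mem_inverseGraph.1 hp)
    exact h.trans_eq (inner_re_symm (𝕜 := ℂ) _ _)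

theorem formCauchy_iff_pairFormCauchy {h : ℕ → S.domain} :
    FormCauchy S h ↔ PairFormCauchy fun n => ((h n : H), S (h n)) := by
  simp only [FormCauchy, PairFormCauchy, LinearPMap.map_sub, Submodule.coe_sub, Prod.fst_sub,
    Prod.snd_sub]

theorem pairFormCauchy_swap {h : ℕ → H × H} :
    (PairFormCauchy fun n => ((h n).2, (h n).1)) ↔ PairFormCauchy h := by
  refine Filter.tendsto_congr fun p => ?_
  exact inner_re_symm (𝕜 := ℂ) _ _

theorem mem_formDomain_iff (hpos : IsNonneg S) {x : H} :
    x ∈ formDomain S hpos ↔ ∃ h : ℕ → H × H, (∀ n, h n ∈ S.graph) ∧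
      Filter.Tendsto (fun n => (h n).1) Filter.atTop (𝓝 x) ∧ PairFormCauchy h := by
  constructor
  · rintro ⟨h, h1, h2⟩
    exact ⟨fun n => (h n, S (h n)), fun n => S.mem_graph _, h1, formCauchy_iff_pairFormCauchy.1 h2⟩
  · rintro ⟨h, hS, h1, h2⟩
    choose k hk using fun n => (LinearPMap.mem_graph_iff' S).1 (hS n)
    obtain rfl : (fun n => ((k n : H), S (k n))) = h := funext hk
    exact ⟨k, h1, formCauchy_iff_pairFormCauchy.2 h2⟩

theorem mem_inverseFormDomain_iff (hpos : IsNonneg S) {y : H} :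
    y ∈ inverseFormDomain S hpos ↔ ∃ h : ℕ → H × H, (∀ n, h n ∈ inverseGraph S) ∧
      Filter.Tendsto (fun n => (h n).1) Filter.atTop (𝓝 y) ∧ PairFormCauchy h := by
  constructor
  · rintro ⟨h, h1, h2⟩
    exact ⟨fun n => (S (h n), h n), fun n => S.mem_graph _, h1,
      pairFormCauchy_swap.1 (formCauchy_iff_pairFormCauchy.1 h2)⟩
  · rintro ⟨h, hS, h1, h2⟩
    choose k hk using fun n => (LinearPMap.mem_graph_iff' S).1 (mem_inverseGraph.1 (hS n))
    obtain rfl : (fun n => (S (k n), (k n : H))) = h :=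
      funext fun n => Prod.ext (congrArg Prod.snd (hk n)) (congrArg Prod.fst (hk n))
    exact ⟨k, h1, formCauchy_iff_pairFormCauchy.2 (pairFormCauchy_swap.1 h2)⟩

variable [CompleteSpace H]

theorem mem_graph_friedrichsExtension_iff (hS : IsSymm S) (hpos : IsNonneg S) {p : H × H} :
    p ∈ (friedrichsExtension S hpos).graph ↔ p ∈ friedrichsRel S.graph := by
  obtain ⟨x, y⟩ := p
  rw [friedrichsExtension, mem_graph_domRestrict, mem_formDomain_iff,
    mem_graph_adjoint_iff hS.dense, and_comm]
  exact and_congr_left' ⟨fun h q hq => h _ _ hq, fun h a b hab => h _ hab⟩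

/-- Swapping components commutes with taking adjoints, and `S*` is single valued, so the domain
condition falls on `y = S* x`. -/
theorem mem_graph_kreinVonNeumannExtension_iff (hS : IsSymm S) (hpos : IsNonneg S) {x y : H} :
    (x, y) ∈ (kreinVonNeumannExtension S hpos).graph ↔
      (y, x) ∈ friedrichsRel (inverseGraph S) := by
  have h1 : (x, y) ∈ (kreinVonNeumannExtension S hpos).graph ↔
      (x, y) ∈ S.adjoint.graph ∧ y ∈ inverseFormDomain S hpos := by
    rw [kreinVonNeumannExtension, mem_graph_domRestrict, and_comm]
    refine and_congr_right fun hxy => ?_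
    obtain ⟨u, hu⟩ := (LinearPMap.mem_graph_iff' _).1 hxy
    obtain ⟨rfl, rfl⟩ := Prod.mk.inj hu
    constructor
    · rintro ⟨v, hv, e⟩
      obtain rfl : v = u := Subtype.ext e
      exact hv
    · exact fun h => ⟨u, h, rfl⟩
  rw [h1, mem_inverseFormDomain_iff, mem_graph_adjoint_iff hS.dense]
  exact and_congr_left' ⟨fun h q hq => (h _ _ (mem_inverseGraph.1 hq)).symm,
    fun h a b hab => (h (b, a) hab).symm⟩

theorem le_friedrichsExtension (hS : IsSymm S) (hpos : IsNonneg S) :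
    S ≤ friedrichsExtension S hpos :=
  LinearPMap.le_of_le_graph fun _ hp => (mem_graph_friedrichsExtension_iff hS hpos).2
    ((hS.isNonnegRel_graph hpos).mem_friedrichsRel hp)

theorem le_kreinVonNeumannExtension (hS : IsSymm S) (hpos : IsNonneg S) :
    S ≤ kreinVonNeumannExtension S hpos :=
  LinearPMap.le_of_le_graph fun _ hp => (mem_graph_kreinVonNeumannExtension_iff hS hpos).2
    ((hS.isNonnegRel_inverseGraph hpos).mem_friedrichsRel (mem_inverseGraph.2 hp))

theorem isSelfAdjoint_friedrichsExtension (hS : IsSymm S) (hpos : IsNonneg S) :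
    IsSelfAdjoint (friedrichsExtension S hpos) := by
  have hR := hS.isNonnegRel_graph hpos
  refine isSelfAdjoint_of_graph (hS.dense.mono (le_friedrichsExtension hS hpos).1) ?_ ?_
  · intro x y a b h h'
    rw [mem_graph_friedrichsExtension_iff hS] at h h'
    exact hR.inner_friedrichsRel h h'
  · intro x y h
    rw [mem_graph_friedrichsExtension_iff hS]
    exact hR.mem_friedrichsRel_of_forall fun q hq =>
      h _ _ ((mem_graph_friedrichsExtension_iff hS hpos).2 hq)

theorem isSelfAdjoint_kreinVonNeumannExtension (hS : IsSymm S) (hpos : IsNonneg S) :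
    IsSelfAdjoint (kreinVonNeumannExtension S hpos) := by
  have hR := hS.isNonnegRel_inverseGraph hpos
  refine isSelfAdjoint_of_graph (hS.dense.mono (le_kreinVonNeumannExtension hS hpos).1) ?_ ?_
  · intro x y a b h h'
    rw [mem_graph_kreinVonNeumannExtension_iff hS] at h h'
    exact (hR.inner_friedrichsRel h h').symm
  · intro x y h
    rw [mem_graph_kreinVonNeumannExtension_iff hS]
    exact hR.mem_friedrichsRel_of_forall fun q hq =>
      (h _ _ ((mem_graph_kreinVonNeumannExtension_iff hS hpos).2 hq)).symm

theorem GraphInvariant.friedrichsExtension (hS : IsSymm S) (hpos : IsNonneg S) {C : H →L[ℂ] H}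
    (hC : GraphInvariant C S) (hC' : GraphInvariant (ContinuousLinearMap.adjoint C) S) :
    GraphInvariant C (friedrichsExtension S hpos) := by
  intro x y h
  rw [mem_graph_friedrichsExtension_iff hS] at h ⊢
  exact (hS.isNonnegRel_graph hpos).map_mem_friedrichsRel (fun p hp => hC _ _ hp)
    (fun p hp => hC' _ _ hp) h

theorem GraphInvariant.kreinVonNeumannExtension (hS : IsSymm S) (hpos : IsNonneg S)
    {C : H →L[ℂ] H} (hC : GraphInvariant C S)
    (hC' : GraphInvariant (ContinuousLinearMap.adjoint C) S) :
    GraphInvariant C (kreinVonNeumannExtension S hpos) := by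
  intro x y h
  rw [mem_graph_kreinVonNeumannExtension_iff hS] at h ⊢
  exact (hS.isNonnegRel_inverseGraph hpos).map_mem_friedrichsRel
    (fun p hp => mem_inverseGraph.2 (hC _ _ (mem_inverseGraph.1 hp)))
    (fun p hp => mem_inverseGraph.2 (hC' _ _ (mem_inverseGraph.1 hp))) h

end Nonneg

end

end CSymm

theorem theorem3p4 {H : Type*} [NormedAddCommGroup H] [InnerProductSpace ℂ H] [CompleteSpace H]
    (J : H →L[ℂ] H) (hJ : CSymm.IsFundamentalSymmetry J)
    (S : H →ₗ.[ℂ] H) (hS : CSymm.IsSymm S) (hdef : CSymm.EqualDefectNumbers S)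
    (hSJ : CSymm.Commutes S J) :
    -- (i)
    (∀ A ∈ CSymm.Upsilon J S, S ≤ A ∧
      ∀ (C : H →L[ℂ] H) (hC : CSymm.HasCSymmetry J S C), CSymm.IsSelfAdjointFor hC.core A) ∧
    -- (ii)
    (S.IsClosed → ∀ r : ℝ, CSymm.IsRegularTypePoint S r →
      CSymm.regularExtension S r ∈ CSymm.Upsilon J S) ∧
    -- (iii)
    (S.IsClosed → ∀ A ∈ CSymm.Upsilon J S, ∃ A' : H →ₗ.[ℂ] H,
      S ≤ A' ∧ IsSelfAdjoint A' ∧ CSymm.Transversal S A A' ∧ A' ∈ CSymm.Upsilon J S) ∧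
    -- (iv)
    (∀ hpos : CSymm.IsNonneg S,
      CSymm.friedrichsExtension S hpos ∈ CSymm.Upsilon J S ∧
      CSymm.kreinVonNeumannExtension S hpos ∈ CSymm.Upsilon J S) := by
  simp only [CSymm.mem_Upsilon_iff hJ hSJ]
  refine ⟨?_, ?_, ?_, ?_⟩
  · rintro A ⟨hSA, hA, hinv⟩
    exact ⟨hSA, fun C hC => CSymm.isSelfAdjointFor_of_graphInvariant hJ hA
      (hinv J (hJ.hasCSymmetry hSJ)) hC (hinv C hC)⟩
  · intro hcl r hr
    exact ⟨CSymm.le_regularExtension hS r, CSymm.isSelfAdjoint_regularExtension hS hcl hr,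
      fun C hC => hC.graphInvariant.regularExtension hS
        (hC.graphInvariant_graph_adjoint hJ hS hSJ) r⟩
  · rintro hcl A ⟨hSA, hA, hinv⟩
    have hle := CSymm.le_transversalExtension (A := A) hS
    have hsa := CSymm.isSelfAdjoint_transversalExtension hS hcl hSA hA
    exact ⟨CSymm.transversalExtension S A, hle, hsa,
      CSymm.transversal_transversalExtension hS hcl hSA hA, hle, hsa,
      fun C hC => hC.graphInvariant.transversalExtension hS
        (hC.graphInvariant_graph_adjoint hJ hS hSJ) (hinv C hC)⟩
  · intro hpos
    exact ⟨⟨CSymm.le_friedrichsExtension hS hpos, CSymm.isSelfAdjoint_friedrichsExtension hS hpos,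
        fun C hC => hC.graphInvariant.friedrichsExtension hS hpos
          (hC.graphInvariant_adjoint hJ hSJ)⟩,
      ⟨CSymm.le_kreinVonNeumannExtension hS hpos,
        CSymm.isSelfAdjoint_kreinVonNeumannExtension hS hpos,
        fun C hC => hC.graphInvariant.kreinVonNeumannExtension hS hpos
          (hC.graphInvariant_adjoint hJ hSJ)⟩⟩
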